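/- Every irrational $x\in(0,1)$ has a unique infinite simple continued fraction expansion $x=[a_1(x),a_2(x),\dots]$ with positive integer partial quotients: with the Gauss map $T(0)=0$, $T(x)=\frac1x-\lfloor \frac1x\rfloor$ for $x\in(0,1)$, one has $a_n(x)=\lfloor 1/T^{n-1}(x)\rfloor$ for $n\ge1$. Put $S_n(x)=\sum_{i=1}^n a_i(x)a_{i+1}(x)$ for $n\ge 1$. Let $\mathbb N=\{1,2,3,\dots\}$ and let $\phi:\mathbb N\to(0,\infty)$ be a monotonically increasing (that is, non-decreasing) function with $$\lim_{n\to\infty}\frac{\phi(n)}{n}=\infty,\qquad \lim_{n\to\infty}\frac{\phi(n+1)}{\phi(n)}=1,\qquad \limsup_{n\to\infty}\frac{\log\log\phi(n)}{\log n}<\frac12 .$$ Then the set $$E(\phi)=\Big\{x\in(0,1)\ \text{irrational}:\ \lim_{n\to\infty}\frac{S_n(x)}{\phi(n)}=1\Big\}$$ has Hausdorff dimension $\dim_{\mathcal H}E(\phi)=1$. -/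

import Mathlib

open Filter Topology

noncomputable section

namespace ContFracSum

/-- The Gauss map `T(0) = 0`, `T(x) = 1/x - ⌊1/x⌋` for `x ≠ 0`; it is used on `[0,1)`. -/
def gaussMap (x : ℝ) : ℝ :=
  if x = 0 then 0 else 1 / x - (⌊1 / x⌋ : ℝ)

/-- The `n`-th partial quotient `a_n(x) = ⌊1 / T^{n-1}(x)⌋`, for `n ≥ 1` and irrational
`x ∈ (0,1)`. The value at the index `n = 0` has no meaning and is never used. -/
def partialQuotient (n : ℕ) (x : ℝ) : ℕ :=
  ⌊1 / (gaussMap^[n - 1] x)⌋₊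

/-- The sum `S_n(x) = ∑_{i=1}^n a_i(x) a_{i+1}(x)` of products of consecutive partial quotients. -/
def productSum (n : ℕ) (x : ℝ) : ℕ :=
  ∑ i ∈ Finset.Icc 1 n, partialQuotient i x * partialQuotient (i + 1) x

/-- The set `E(φ)` of irrational `x ∈ (0,1)` such that `S_n(x) / φ(n) → 1`. -/
def levelSet (φ : ℕ → ℝ) : Set ℝ :=
  {x : ℝ | x ∈ Set.Ioo (0 : ℝ) 1 ∧ Irrational x ∧
    Tendsto (fun n : ℕ => (productSum n x : ℝ) / φ n) atTop (𝓝 1)}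

end ContFracSum

end

/-! The upper bound is trivial. For the lower bound, a large subset of `levelSet φ` is built from
rare forced digits, all other digits being free in {1, …, M}.

A forced block 1, d, 1 adds 2d plus a bounded error to the sum of products. If the d are the
increments of integers u(j) asymptotic to φ(3j + 1)/2, the sum is asymptotic to φ(n), because the
bounded errors add up to O(n) = o(φ(n)) (`tendsto_sum_div`). Forced blocks are kept rare by letting
u follow the staircase of values exp(k^γ)/2 with γ < 1: consecutive values have ratio tending to 1,
so the staircase still tracks φ/2, yet its level is at most (log φ)^(1/γ).

Forcing a digit d costs a factor of order d² in relative cylinder length, so the logarithm of the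
cost of the forced blocks is O((log φ(n))^(1 + 1/γ)). With log φ(n) ≤ n^β and β < 1/2, a γ close to
1 makes this o(n) (`eventually_level_mul_log_le`). A free digit costs at most (M + 2)/M, which is
near 1 for large M. Cylinders of order n have length at most 2^(-n), so such a cost is harmless.

The dimension bound `le_dimH_obeys` uses a coding of t ∈ [0,1) by admissible digits. Its inverse is
s-Hölder and onto [0,1), so the coded set has dimension at least s, and s < 1 is arbitrary. -/

namespace ContFracSum

/-! ### Infinite continued fractions with given digits -/

/-- The `n`-th truncation of the continued fraction `[a 0, a 1, …]`. -/
noncomputable def cfTrunc : ℕ → (ℕ → ℕ) → ℝ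
  | 0, _ => 0
  | n + 1, a => 1 / ((a 0 : ℝ) + cfTrunc n (fun i => a (i + 1)))

/-- The value of the continued fraction `[a 0, a 1, …]`. -/
noncomputable def cfVal (a : ℕ → ℕ) : ℝ :=
  limUnder atTop (fun n => cfTrunc n a)

lemma cfTrunc_mem_Icc (n : ℕ) {a : ℕ → ℕ} (ha : ∀ i, 1 ≤ a i) :
    0 ≤ cfTrunc n a ∧ cfTrunc n a ≤ 1 := by
  induction n generalizing a with
  | zero => simp [cfTrunc]
  | succ n ih =>
    have h := ih (a := fun i => a (i + 1)) (fun i => ha _)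
    have h0 : (1 : ℝ) ≤ a 0 := by exact_mod_cast ha 0
    simp only [cfTrunc]
    refine ⟨by have := h.1; positivity, ?_⟩
    rw [div_le_one (by linarith [h.1])]
    linarith [h.1]

lemma abs_one_div_add_sub {b s t : ℝ} (hs : b + s ≠ 0) (ht : b + t ≠ 0) :
    |1 / (b + s) - 1 / (b + t)| = |s - t| * (|1 / (b + s)| * |1 / (b + t)|) := by
  rw [← abs_mul, ← abs_mul, ← abs_neg]
  congr 1
  field_simp
  ring

/-- One step x ↦ 1/(b + x) is not a uniform contraction (slope -1 at b = 1, x = 0). Over two steps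
the derivative factors combine to 1/(b(c + r) + 1) ≤ 1/2 at each endpoint. -/
lemma two_step_contraction {b c s t : ℝ} (hb : 1 ≤ b) (hc : 1 ≤ c) (hs : 0 ≤ s) (ht : 0 ≤ t) :
    |1 / (b + 1 / (c + s)) - 1 / (b + 1 / (c + t))| ≤ |s - t| / 4 := by
  have h1 : ∀ r : ℝ, 0 ≤ r → 0 < c + r ∧ 0 < 1 / (c + r) ∧
      |1 / (b + 1 / (c + r))| * |1 / (c + r)| ≤ 1 / 2 := by
    intro r hr
    have : 0 < c + r := by linarith
    refine ⟨this, by positivity, ?_⟩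
    rw [← abs_mul, show 1 / (b + 1 / (c + r)) * (1 / (c + r)) = 1 / (b * (c + r) + 1) by
      field_simp, abs_of_pos (by positivity)]
    apply one_div_le_one_div_of_le (by norm_num)
    nlinarith
  obtain ⟨hs1, hs2, hs3⟩ := h1 s hs
  obtain ⟨ht1, ht2, ht3⟩ := h1 t ht
  rw [abs_one_div_add_sub (by positivity) (by positivity),
    abs_one_div_add_sub (by positivity) (by positivity)]
  have := mul_le_mul hs3 ht3 (by positivity) (by norm_num)
  calc _ = |s - t| * ((|1 / (b + 1 / (c + s))| * |1 / (c + s)|) *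
        (|1 / (b + 1 / (c + t))| * |1 / (c + t)|)) := by ring
    _ ≤ |s - t| * (1 / 2 * (1 / 2)) := by gcongr
    _ = _ := by ring

lemma abs_cfTrunc_sub_le (n : ℕ) {a : ℕ → ℕ} (ha : ∀ i, 1 ≤ a i) :
    |cfTrunc n a - cfTrunc (n + 1) a| ≤ 2 * (1 / 2) ^ n := by
  induction n using Nat.strong_induction_on generalizing a with
  | _ n ih =>
    rcases n with _ | _ | n
    · have h1 := cfTrunc_mem_Icc 0 ha
      have h2 := cfTrunc_mem_Icc 1 ha
      rw [abs_le]
      norm_num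
      constructor <;> linarith [h1.1, h1.2, h2.1, h2.2]
    · have h1 := cfTrunc_mem_Icc 1 ha
      have h2 := cfTrunc_mem_Icc 2 ha
      rw [abs_le]
      norm_num
      constructor <;> linarith [h1.1, h1.2, h2.1, h2.2]
    · have h := ih n (by omega) (a := fun i => a (i + 2)) (fun i => ha _)
      have h0 : (1 : ℝ) ≤ a 0 := by exact_mod_cast ha 0
      have h1 : (1 : ℝ) ≤ a 1 := by exact_mod_cast ha 1
      have := two_step_contraction h0 h1
        (cfTrunc_mem_Icc n (a := fun i => a (i + 2)) (fun i => ha _)).1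
        (cfTrunc_mem_Icc (n + 1) (a := fun i => a (i + 2)) (fun i => ha _)).1
      have e : ∀ m, cfTrunc (m + 2) a = 1 / ((a 0 : ℝ) + 1 / (a 1 + cfTrunc m (fun i => a (i + 2)))) :=
        fun m => rfl
      rw [e n, show n + 1 + 1 + 1 = (n + 1) + 2 from rfl, e (n + 1)]
      refine this.trans ?_
      rw [pow_succ, pow_succ]
      linarith

lemma tendsto_cfTrunc {a : ℕ → ℕ} (ha : ∀ i, 1 ≤ a i) :
    Tendsto (fun n => cfTrunc n a) atTop (𝓝 (cfVal a)) := by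
  apply CauchySeq.tendsto_limUnder
  apply cauchySeq_of_le_geometric (1 / 2) 2 (by norm_num)
  intro n
  rw [Real.dist_eq]
  exact abs_cfTrunc_sub_le n ha

lemma cfVal_mem_Icc {a : ℕ → ℕ} (ha : ∀ i, 1 ≤ a i) : 0 ≤ cfVal a ∧ cfVal a ≤ 1 :=
  ⟨ge_of_tendsto' (tendsto_cfTrunc ha) fun n => (cfTrunc_mem_Icc n ha).1,
    le_of_tendsto' (tendsto_cfTrunc ha) fun n => (cfTrunc_mem_Icc n ha).2⟩

lemma cfVal_eq {a : ℕ → ℕ} (ha : ∀ i, 1 ≤ a i) :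
    cfVal a = 1 / ((a 0 : ℝ) + cfVal (fun i => a (i + 1))) := by
  have h0 : (1 : ℝ) ≤ a 0 := by exact_mod_cast ha 0
  have hs : ∀ i, 1 ≤ a (i + 1) := fun i => ha _
  have h1 : Tendsto (fun n => cfTrunc (n + 1) a) atTop
      (𝓝 (1 / ((a 0 : ℝ) + cfVal (fun i => a (i + 1))))) := by
    simp only [cfTrunc]
    refine Tendsto.div tendsto_const_nhds (tendsto_const_nhds.add (tendsto_cfTrunc hs)) ?_
    linarith [(cfVal_mem_Icc hs).1]
  exact tendsto_nhds_unique ((tendsto_add_atTop_iff_nat 1).2 (tendsto_cfTrunc ha)) h1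

lemma one_div_le_cfVal {a : ℕ → ℕ} (ha : ∀ i, 1 ≤ a i) : 1 / ((a 0 : ℝ) + 1) ≤ cfVal a := by
  have hs := cfVal_mem_Icc (a := fun i => a (i + 1)) (fun i => ha _)
  have h0 : (1 : ℝ) ≤ a 0 := by exact_mod_cast ha 0
  rw [cfVal_eq ha]
  apply one_div_le_one_div_of_le <;> linarith [hs.1, hs.2]

lemma cfVal_pos {a : ℕ → ℕ} (ha : ∀ i, 1 ≤ a i) : 0 < cfVal a :=
  lt_of_lt_of_le (by positivity) (one_div_le_cfVal ha)

lemma cfVal_lt_one {a : ℕ → ℕ} (ha : ∀ i, 1 ≤ a i) : cfVal a < 1 := by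
  have h0 : (1 : ℝ) ≤ a 0 := by exact_mod_cast ha 0
  have hs := cfVal_pos (a := fun i => a (i + 1)) (fun i => ha _)
  rw [cfVal_eq ha, div_lt_one (by linarith)]
  linarith

lemma one_div_cfVal {a : ℕ → ℕ} (ha : ∀ i, 1 ≤ a i) :
    1 / cfVal a = a 0 + cfVal (fun i => a (i + 1)) := by
  rw [cfVal_eq ha, one_div_one_div]

/-- Infinite descent: if the value is p/q, then 0 < p < q and the tail has value (q - a₀p)/p, with
smaller denominator. -/
lemma cfVal_ne_natCast_div (q : ℕ) {a : ℕ → ℕ} (ha : ∀ i, 1 ≤ a i) (p : ℤ) :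
    cfVal a ≠ p / q := by
  induction q using Nat.strong_induction_on generalizing a p with
  | _ q ih =>
    intro h
    have hpos := cfVal_pos ha
    have hlt := cfVal_lt_one ha
    have hq : 0 < (q : ℝ) := by
      rcases Nat.eq_zero_or_pos q with rfl | hq
      · simp [h] at hpos
      · exact_mod_cast hq
    have hp : 0 < p := by
      rw [h, lt_div_iff₀ hq, zero_mul] at hpos
      exact_mod_cast hpos
    have hpq : p < q := by
      rw [h, div_lt_one hq] at hlt
      exact_mod_cast hlt
    lift p to ℕ using hp.le
    refine ih p (by omega) (a := fun i => a (i + 1)) (fun i => ha _) (q - a 0 * p) ?_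
    have h1 := one_div_cfVal ha
    rw [h] at h1
    have hp' : (p : ℝ) ≠ 0 := by
      have : (0 : ℝ) < p := by exact_mod_cast hp
      exact this.ne'
    have : cfVal (fun i => a (i + 1)) = 1 / (((p : ℤ) : ℝ) / q) - a 0 := by linarith
    rw [this]
    push_cast
    field_simp

lemma irrational_cfVal {a : ℕ → ℕ} (ha : ∀ i, 1 ≤ a i) : Irrational (cfVal a) := by
  rintro ⟨r, hr⟩
  apply cfVal_ne_natCast_div r.den ha r.num
  rw [← hr]
  exact_mod_cast (Rat.num_div_den r).symm

lemma floor_one_div_cfVal {a : ℕ → ℕ} (ha : ∀ i, 1 ≤ a i) : ⌊1 / cfVal a⌋ = a 0 := by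
  have hs : ∀ i, 1 ≤ a (i + 1) := fun i => ha _
  rw [one_div_cfVal ha, Int.floor_eq_iff]
  push_cast
  constructor <;> linarith [cfVal_pos hs, cfVal_lt_one hs]

lemma gaussMap_cfVal {a : ℕ → ℕ} (ha : ∀ i, 1 ≤ a i) :
    gaussMap (cfVal a) = cfVal (fun i => a (i + 1)) := by
  rw [gaussMap, if_neg (cfVal_pos ha).ne', floor_one_div_cfVal ha, one_div_cfVal ha]
  simp

lemma gaussMap_iterate_cfVal (n : ℕ) {a : ℕ → ℕ} (ha : ∀ i, 1 ≤ a i) :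
    gaussMap^[n] (cfVal a) = cfVal (fun i => a (i + n)) := by
  induction n generalizing a with
  | zero => rfl
  | succ n ih =>
    rw [Function.iterate_succ_apply, gaussMap_cfVal ha, ih (fun i => ha _)]
    rfl

lemma partialQuotient_cfVal (n : ℕ) {a : ℕ → ℕ} (ha : ∀ i, 1 ≤ a i) :
    partialQuotient (n + 1) (cfVal a) = a n := by
  rw [partialQuotient, Nat.add_sub_cancel, gaussMap_iterate_cfVal n ha, ← Int.floor_toNat,
    floor_one_div_cfVal (fun i => ha _)]
  simp

lemma productSum_cfVal (n : ℕ) {a : ℕ → ℕ} (ha : ∀ i, 1 ≤ a i) :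
    productSum n (cfVal a) = ∑ i ∈ Finset.range n, a i * a (i + 1) := by
  induction n with
  | zero => simp [productSum]
  | succ n ih =>
    rw [Finset.sum_range_succ, ← ih, productSum, Finset.sum_Icc_succ_top (by omega),
      partialQuotient_cfVal n ha, partialQuotient_cfVal (n + 1) ha]
    rfl

/-! ### Cylinder lengths and distances -/

/-- The denominators `(q_{n-1}, q_n)` of two consecutive convergents of `[a 0, a 1, …]`. -/
def denPair (a : ℕ → ℕ) : ℕ → ℕ × ℕ
  | 0 => (0, 1)
  | n + 1 => ((denPair a n).2, a n * (denPair a n).2 + (denPair a n).1)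

lemma denPair_congr {a b : ℕ → ℕ} {n : ℕ} (h : ∀ i < n, a i = b i) :
    denPair a n = denPair b n := by
  induction n with
  | zero => rfl
  | succ n ih => rw [denPair, denPair, ih fun i hi => h i (by omega), h n (by omega)]

lemma denPair_bounds {a : ℕ → ℕ} (ha : ∀ i, 1 ≤ a i) (n : ℕ) :
    1 ≤ (denPair a n).2 ∧ (denPair a n).1 ≤ (denPair a n).2 := by
  induction n with
  | zero => simp [denPair]
  | succ n ih =>
    have := Nat.mul_le_mul_right (denPair a n).2 (ha n)
    simp only [denPair]
    omega

/-- The quotient `q_{n-1} / q_n`. -/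
noncomputable def denRatio (a : ℕ → ℕ) (n : ℕ) : ℝ :=
  ((denPair a n).1 : ℝ) / (denPair a n).2

/-- The length of the cylinder of order `n` with digits `a 0, …, a (n - 1)`. -/
noncomputable def cylLength (a : ℕ → ℕ) (n : ℕ) : ℝ :=
  1 / ((denPair a n).2 * ((denPair a n).2 + (denPair a n).1) : ℝ)

/-- The proportion of a cylinder with `q_{n-1} / q_n = θ` that is filled by its subcylinder
with next digit `b`. -/
noncomputable def digitWeight (θ : ℝ) (b : ℕ) : ℝ :=
  (1 + θ) / ((b + θ) * (b + 1 + θ))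

lemma denRatio_mem_Icc {a : ℕ → ℕ} (ha : ∀ i, 1 ≤ a i) (n : ℕ) :
    0 ≤ denRatio a n ∧ denRatio a n ≤ 1 := by
  have h := denPair_bounds ha n
  have h1 : (0 : ℝ) < (denPair a n).2 := by exact_mod_cast h.1
  have h2 : ((denPair a n).1 : ℝ) ≤ (denPair a n).2 := by exact_mod_cast h.2
  exact ⟨by unfold denRatio; positivity, (div_le_one h1).2 h2⟩

lemma denRatio_succ {a : ℕ → ℕ} (ha : ∀ i, 1 ≤ a i) (n : ℕ) :
    denRatio a (n + 1) = 1 / (a n + denRatio a n) := by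
  have h := denPair_bounds ha n
  have h1 : (0 : ℝ) < (denPair a n).2 := by exact_mod_cast h.1
  simp only [denRatio, denPair]
  push_cast
  field_simp

lemma cylLength_pos {a : ℕ → ℕ} (ha : ∀ i, 1 ≤ a i) (n : ℕ) : 0 < cylLength a n := by
  have h := denPair_bounds ha n
  have h1 : (0 : ℝ) < (denPair a n).2 := by exact_mod_cast h.1
  unfold cylLength
  positivity

lemma cylLength_succ {a : ℕ → ℕ} (ha : ∀ i, 1 ≤ a i) (n : ℕ) :
    cylLength a (n + 1) = cylLength a n * digitWeight (denRatio a n) (a n) := by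
  have h := denPair_bounds ha n
  have h1 : (0 : ℝ) < (denPair a n).2 := by exact_mod_cast h.1
  have h2 : (1 : ℝ) ≤ a n := by exact_mod_cast ha n
  simp only [cylLength, denRatio, digitWeight, denPair]
  push_cast
  field_simp
  ring

lemma digitWeight_pos {θ : ℝ} {b : ℕ} (hθ : 0 ≤ θ) (hb : 1 ≤ b) : 0 < digitWeight θ b := by
  have h2 : (1 : ℝ) ≤ b := by exact_mod_cast hb
  unfold digitWeight
  positivity

lemma digitWeight_le_half {θ : ℝ} {b : ℕ} (hθ : 0 ≤ θ) (hb : 1 ≤ b) :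
    digitWeight θ b ≤ 1 / 2 := by
  have h2 : (1 : ℝ) ≤ b := by exact_mod_cast hb
  unfold digitWeight
  rw [div_le_div_iff₀ (by positivity) (by norm_num)]
  nlinarith [mul_nonneg hθ (sub_nonneg.2 h2)]

/-- Source of the cost 6d² of a forced digit: its weight is at least 1/(6d²), whatever the past
digits. -/
lemma one_le_mul_digitWeight {θ : ℝ} {b : ℕ} (hθ : 0 ≤ θ) (hθ1 : θ ≤ 1) (hb : 1 ≤ b) :
    1 ≤ 6 * (b : ℝ) ^ 2 * digitWeight θ b := by
  have h2 : (1 : ℝ) ≤ b := by exact_mod_cast hb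
  unfold digitWeight
  rw [mul_div_assoc', le_div_iff₀ (by positivity), one_mul]
  have h3 : (b + θ) * (b + 1 + θ) ≤ (b + 1) * (b + 1 + 1 : ℝ) := by gcongr
  nlinarith [mul_nonneg hθ (sq_nonneg (b : ℝ))]

lemma cylLength_le {a : ℕ → ℕ} (ha : ∀ i, 1 ≤ a i) (n : ℕ) : cylLength a n ≤ (1 / 2) ^ n := by
  induction n with
  | zero => simp [cylLength, denPair]
  | succ n ih =>
    rw [cylLength_succ ha, pow_succ]
    have hθ := denRatio_mem_Icc ha n
    exact mul_le_mul ih (digitWeight_le_half hθ.1 (ha n)) (digitWeight_pos hθ.1 (ha n)).le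
      (by positivity)

/-- The value is a Möbius function of the tail with determinant ±1 and denominator q_n + x q_{n-1}.
The induction avoids numerators: removing one more digit divides each such denominator by the old
tail, while the tail difference loses the product of both old tails. -/
lemma abs_cfVal_sub_mul {a b : ℕ → ℕ} (ha : ∀ i, 1 ≤ a i) (hb : ∀ i, 1 ≤ b i) {n : ℕ}
    (h : ∀ i < n, a i = b i) :
    |cfVal a - cfVal b| *
      (((denPair a n).2 + cfVal (fun i => a (i + n)) * (denPair a n).1) *
        ((denPair a n).2 + cfVal (fun i => b (i + n)) * (denPair a n).1)) =
      |cfVal (fun i => a (i + n)) - cfVal (fun i => b (i + n))| := by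
  induction n with
  | zero => simp [denPair]
  | succ n ih =>
    have h1 := ih fun i hi => h i (by omega)
    have ha' : ∀ i, 1 ≤ a (i + n) := fun i => ha _
    have hb' : ∀ i, 1 ≤ b (i + n) := fun i => hb _
    have ea : (fun i => a (i + 1 + n)) = fun i => a (i + (n + 1)) := by
      funext i; congr 1; omega
    have eb : (fun i => b (i + 1 + n)) = fun i => b (i + (n + 1)) := by
      funext i; congr 1; omega
    have pa := cfVal_pos ha'
    have pb := cfVal_pos hb'
    have qa := one_div_cfVal ha'
    have qb := one_div_cfVal hb'
    simp only [zero_add, ea, eb, ← h n (by omega)] at qa qb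
    set x := cfVal fun i => a (i + n)
    set y := cfVal fun i => b (i + n)
    set x' := cfVal fun i => a (i + (n + 1))
    set y' := cfVal fun i => b (i + (n + 1))
    have hxy : |x - y| = |x' - y'| * (x * y) := by
      have : x - y = -((x' - y') * (x * y)) := by
        have hx : x' = 1 / x - a n := by linarith
        have hy : y' = 1 / y - a n := by linarith
        rw [hx, hy]
        field_simp
        ring
      rw [this, abs_neg, abs_mul, abs_of_pos (mul_pos pa pb)]
    rw [hxy] at h1
    have e1 : ((denPair a n).2 + x * (denPair a n).1 : ℝ) =
        x * ((denPair a (n + 1)).2 + x' * (denPair a (n + 1)).1) := by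
      have hx : x' = 1 / x - a n := by linarith
      simp only [denPair]
      push_cast
      rw [hx]
      field_simp
      ring
    have e2 : ((denPair a n).2 + y * (denPair a n).1 : ℝ) =
        y * ((denPair a (n + 1)).2 + y' * (denPair a (n + 1)).1) := by
      have hy : y' = 1 / y - a n := by linarith
      simp only [denPair]
      push_cast
      rw [hy]
      field_simp
      ring
    rw [e1, e2] at h1
    have hxy0 : x * y ≠ 0 := (mul_pos pa pb).ne'
    apply mul_right_cancel₀ hxy0
    rw [← h1]
    ring

lemma cylLength_mul_le_abs_cfVal_sub {a b : ℕ → ℕ} (ha : ∀ i, 1 ≤ a i) (hb : ∀ i, 1 ≤ b i)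
    {n : ℕ} (h : ∀ i < n, a i = b i) :
    cylLength a n * |cfVal (fun i => a (i + n)) - cfVal (fun i => b (i + n))| ≤
      2 * |cfVal a - cfVal b| := by
  rw [← abs_cfVal_sub_mul ha hb h]
  have hd := denPair_bounds ha n
  have xa := cfVal_mem_Icc (a := fun i => a (i + n)) fun i => ha _
  have xb := cfVal_mem_Icc (a := fun i => b (i + n)) fun i => hb _
  set x := cfVal fun i => a (i + n)
  set y := cfVal fun i => b (i + n)
  have h1 : (1 : ℝ) ≤ (denPair a n).2 := by exact_mod_cast hd.1
  have h2 : ((denPair a n).1 : ℝ) ≤ (denPair a n).2 := by exact_mod_cast hd.2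
  have h3 : (0 : ℝ) ≤ (denPair a n).1 := by positivity
  unfold cylLength
  set q : ℝ := ((denPair a n).2 : ℝ)
  set p : ℝ := ((denPair a n).1 : ℝ)
  rw [one_div_mul_eq_div, div_le_iff₀ (by positivity)]
  have e : ∀ z : ℝ, 0 ≤ z ∧ z ≤ 1 → 0 ≤ q + z * p ∧ q + z * p ≤ q + p := fun z hz =>
    ⟨by have := mul_nonneg hz.1 h3; linarith, by nlinarith⟩
  have h4 : (q + x * p) * (q + y * p) ≤ 2 * (q * (q + p)) := by
    calc _ ≤ (q + p) * (q + p) :=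
          mul_le_mul (e x xa).2 (e y xb).2 (e y xb).1 (by linarith)
      _ ≤ _ := by nlinarith
  calc _ ≤ |cfVal a - cfVal b| * (2 * (q * (q + p))) := by gcongr
    _ = _ := by ring

/-- Since 1/y - 1/x = (b₀ - a₀) + y' - x' with b₀ - a₀ ≥ 1 and x' < 1, the gap is at least y' ≥
1/(b₁ + 1); this is where the second digit enters. The other two factors 1/B bound x and y below. -/
lemma abs_cfVal_sub_of_lt {a b : ℕ → ℕ} (ha : ∀ i, 1 ≤ a i) (hb : ∀ i, 1 ≤ b i)
    (h : a 0 < b 0) {B : ℝ} (h0 : (b 0 : ℝ) + 1 ≤ B) (h1 : (b 1 : ℝ) + 1 ≤ B) :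
    1 ≤ B ^ 3 * |cfVal a - cfVal b| := by
  have ha' : ∀ i, 1 ≤ a (i + 1) := fun i => ha _
  have hb' : ∀ i, 1 ≤ b (i + 1) := fun i => hb _
  have xa := cfVal_pos ha
  have xb := cfVal_pos hb
  have ya := cfVal_lt_one ha'
  have yb := one_div_le_cfVal hb'
  have ea := one_div_cfVal ha
  have eb := one_div_cfVal hb
  have la := one_div_le_cfVal ha
  have lb := one_div_le_cfVal hb
  simp only [zero_add] at yb
  set x := cfVal a
  set y := cfVal b
  set x' := cfVal fun i => a (i + 1)
  set y' := cfVal fun i => b (i + 1)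
  have hab : (a 0 : ℝ) + 1 ≤ b 0 := by exact_mod_cast h
  have hB : 0 < B := by have : (0 : ℝ) ≤ b 0 := by positivity
                        linarith
  have hxB : 1 / B ≤ x := (one_div_le_one_div_of_le (by positivity) (by linarith)).trans la
  have hyB : 1 / B ≤ y := (one_div_le_one_div_of_le (by positivity) h0).trans lb
  have hyB' : 1 / B ≤ y' := (one_div_le_one_div_of_le (by positivity) h1).trans yb
  have e : x - y = (1 / y - 1 / x) * (x * y) := by field_simp
  have h5 : 1 / B ≤ 1 / y - 1 / x := by rw [ea, eb]; linarith
  have h6 : 1 / B * (1 / B * (1 / B)) ≤ x - y := by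
    rw [e]
    gcongr
    exact h5.trans' (by positivity)
  have h7 := h6.trans (le_abs_self _)
  calc (1 : ℝ) = B ^ 3 * (1 / B * (1 / B * (1 / B))) := by field_simp
    _ ≤ _ := by gcongr

lemma abs_cfVal_sub_of_ne {a b : ℕ → ℕ} (ha : ∀ i, 1 ≤ a i) (hb : ∀ i, 1 ≤ b i)
    (h : a 0 ≠ b 0) {B : ℝ} (ha0 : (a 0 : ℝ) + 1 ≤ B) (ha1 : (a 1 : ℝ) + 1 ≤ B)
    (hb0 : (b 0 : ℝ) + 1 ≤ B) (hb1 : (b 1 : ℝ) + 1 ≤ B) :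
    1 ≤ B ^ 3 * |cfVal a - cfVal b| := by
  rcases h.lt_or_gt with h | h
  · exact abs_cfVal_sub_of_lt ha hb h hb0 hb1
  · rw [abs_sub_comm]
    exact abs_cfVal_sub_of_lt hb ha h ha0 ha1

/-! ### Costs of prescriptions and the coding of [0,1) -/

/-- The factor by which a digit with prescription `d` may lower the relative length of a cylinder:
`d = 0` stands for a free digit in `{1, …, M}`, and `d ≠ 0` for a digit that has to be `d`. -/
noncomputable def digitCost (M d : ℕ) : ℝ :=
  if d = 0 then ((M : ℝ) + 2) / M else 6 * (d : ℝ) ^ 2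

/-- The accumulated cost of the first `n` prescriptions. -/
noncomputable def totalCost (M : ℕ) (d : ℕ → ℕ) (n : ℕ) : ℝ :=
  ∏ i ∈ Finset.range n, digitCost M (d i)

/-- The digit sequences that obey the prescriptions `d`, with free digits at most `M`. -/
def Obeys (M : ℕ) (d a : ℕ → ℕ) : Prop :=
  ∀ i, 1 ≤ a i ∧ (d i = 0 → a i ≤ M) ∧ (d i ≠ 0 → a i = d i)

/-- One step of the coding of numbers `r ∈ [0,1)` by digits: it yields the digit `b` and the
remainder `r'`. -/
def DigitStep (M d : ℕ) (θ r : ℝ) (b : ℕ) (r' : ℝ) : Prop :=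
  1 ≤ b ∧ 0 ≤ r' ∧ r' < 1 ∧
    ((d = 0 ∧ b ≤ M ∧ r * (M / (M + 1 + θ)) = ((b : ℝ) - 1) / (b + θ) + digitWeight θ b * r') ∨
      (d ≠ 0 ∧ b = d ∧ r' = r))

lemma one_le_digitCost {M : ℕ} (hM : 1 ≤ M) (d : ℕ) : 1 ≤ digitCost M d := by
  have hM' : (1 : ℝ) ≤ M := by exact_mod_cast hM
  unfold digitCost
  split_ifs with h
  · rw [le_div_iff₀ (by positivity)]; linarith
  · have : (1 : ℝ) ≤ d := by exact_mod_cast Nat.one_le_iff_ne_zero.2 h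
    nlinarith

lemma totalCost_succ (M : ℕ) (d : ℕ → ℕ) (n : ℕ) :
    totalCost M d (n + 1) = totalCost M d n * digitCost M (d n) :=
  Finset.prod_range_succ _ _

lemma one_le_totalCost {M : ℕ} (hM : 1 ≤ M) (d : ℕ → ℕ) (n : ℕ) : 1 ≤ totalCost M d n := by
  induction n with
  | zero => simp [totalCost]
  | succ n ih =>
    rw [totalCost_succ]
    exact one_le_mul_of_one_le_of_one_le ih (one_le_digitCost hM _)

lemma totalCost_mono {M : ℕ} (hM : 1 ≤ M) (d : ℕ → ℕ) : Monotone (totalCost M d) := by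
  refine monotone_nat_of_le_succ fun n => ?_
  rw [totalCost_succ]
  exact le_mul_of_one_le_right (by linarith [one_le_totalCost hM d n]) (one_le_digitCost hM _)

lemma digitCost_le_totalCost {M : ℕ} (hM : 1 ≤ M) (d : ℕ → ℕ) {i n : ℕ} (h : i < n) :
    digitCost M (d i) ≤ totalCost M d n := by
  refine le_trans ?_ (totalCost_mono hM d (Nat.succ_le_of_lt h))
  rw [Nat.succ_eq_add_one, totalCost_succ]
  exact le_mul_of_one_le_left (by linarith [one_le_digitCost hM (d i)]) (one_le_totalCost hM d i)

lemma Obeys.add_one_le {M : ℕ} (hM : 1 ≤ M) {d a : ℕ → ℕ} (h : Obeys M d a) {i n : ℕ}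
    (hi : i < n) : (a i : ℝ) + 1 ≤ (M + 1) * totalCost M d n := by
  have hM' : (1 : ℝ) ≤ M := by exact_mod_cast hM
  have h1 := digitCost_le_totalCost hM d hi
  have h2 := one_le_totalCost hM d n
  obtain ⟨h3, h4, h5⟩ := h i
  by_cases hd : d i = 0
  · have : (a i : ℝ) ≤ M := by exact_mod_cast h4 hd
    nlinarith
  · rw [digitCost, if_neg hd, ← h5 hd] at h1
    have : (1 : ℝ) ≤ a i := by exact_mod_cast h3
    nlinarith

/-- The weights telescope: digits 1, …, c together fill the proportion c/(c + 1 + θ) of a cylinder.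
So r is rescaled to the part filled by digits up to M, and b is the digit whose slot contains it. -/
lemma exists_free_digit {M : ℕ} (hM : 1 ≤ M) {θ r : ℝ} (hθ : 0 ≤ θ) (h0 : 0 ≤ r) (h1 : r < 1) :
    ∃ b r', DigitStep M 0 θ r b r' := by
  have hM' : (1 : ℝ) ≤ M := by exact_mod_cast hM
  set ρ := r * (M / (M + 1 + θ)) with hρ
  have hρ0 : 0 ≤ ρ := by positivity
  have hex : ∃ b : ℕ, ρ < (b : ℝ) / (b + 1 + θ) := by
    refine ⟨M, ?_⟩
    rw [hρ]
    exact mul_lt_of_lt_one_left (by positivity) h1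
  classical
  obtain ⟨c, hc⟩ : ∃ c, Nat.find hex = c + 1 := by
    refine Nat.exists_eq_succ_of_ne_zero fun h => ?_
    have := Nat.find_spec hex
    rw [h] at this
    simp at this
    linarith
  have hs := Nat.find_spec hex
  have hm := Nat.find_min hex (m := c) (by omega)
  have hle : Nat.find hex ≤ M := by
    refine Nat.find_min' hex ?_
    rw [hρ]
    exact mul_lt_of_lt_one_left (by positivity) h1
  rw [hc] at hs hle
  rw [not_lt] at hm
  have hw := digitWeight_pos hθ (b := c + 1) (by omega)
  have e1 : (((c + 1 : ℕ) : ℝ) - 1) / ((c + 1 : ℕ) + θ) = c / (c + 1 + θ) := by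
    push_cast; ring
  have e2 : ((c + 1 : ℕ) : ℝ) / ((c + 1 : ℕ) + 1 + θ) =
      c / (c + 1 + θ) + digitWeight θ (c + 1) := by
    unfold digitWeight
    push_cast
    have : (0 : ℝ) ≤ c := by positivity
    field_simp
    ring
  rw [e2] at hs
  refine ⟨c + 1, (ρ - c / (c + 1 + θ)) / digitWeight θ (c + 1), by omega, ?_, ?_,
    Or.inl ⟨rfl, hle, ?_⟩⟩
  · exact div_nonneg (by linarith) hw.le
  · rw [div_lt_one hw]; linarith
  · rw [e1, mul_div_cancel₀ _ hw.ne']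
    ring

lemma exists_digitStep {M : ℕ} (hM : 1 ≤ M) (d : ℕ) {θ r : ℝ} (hθ : 0 ≤ θ) (h0 : 0 ≤ r)
    (h1 : r < 1) : ∃ b r', DigitStep M d θ r b r' := by
  by_cases hd : d = 0
  · subst hd
    exact exists_free_digit hM hθ h0 h1
  · exact ⟨d, r, Nat.one_le_iff_ne_zero.2 hd, h0, h1, Or.inr ⟨hd, rfl, rfl⟩⟩

/-- A free step stretches by the digit weight times (M + 1 + θ)/M. A forced step leaves r unchanged,
and there cost times weight is at least 1. -/
lemma DigitStep.abs_sub_le {M d b : ℕ} (hM : 1 ≤ M) {θ r₁ r₂ s₁ s₂ : ℝ} (hθ : 0 ≤ θ) (hθ1 : θ ≤ 1)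
    (h₁ : DigitStep M d θ r₁ b s₁) (h₂ : DigitStep M d θ r₂ b s₂) :
    |r₁ - r₂| ≤ digitCost M d * digitWeight θ b * |s₁ - s₂| := by
  have hM' : (1 : ℝ) ≤ M := by exact_mod_cast hM
  obtain ⟨hb, -, -, ⟨hd, -, e₁⟩ | ⟨hd, hbd, e₁⟩⟩ := h₁
  · obtain ⟨-, -, -, ⟨-, -, e₂⟩ | ⟨hd', -⟩⟩ := h₂
    swap
    · exact absurd hd hd'
    have hw := digitWeight_pos hθ hb
    have e : r₁ - r₂ = (M + 1 + θ) / M * digitWeight θ b * (s₁ - s₂) := by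
      have e₃ : (r₁ - r₂) * (M / (M + 1 + θ)) = digitWeight θ b * (s₁ - s₂) := by linarith
      rw [mul_assoc, ← e₃]
      field_simp
    rw [e, abs_mul, abs_of_pos (by positivity), digitCost, if_pos hd]
    have hle : (M : ℝ) + 1 + θ ≤ M + 2 := by linarith
    gcongr ?_ / _ * _ * _
  · obtain ⟨-, -, -, ⟨hd', -⟩ | ⟨-, -, e₂⟩⟩ := h₂
    · exact absurd hd' hd
    rw [e₁, e₂, digitCost, if_neg hd, ← hbd]
    exact le_mul_of_one_le_left (abs_nonneg _) (one_le_mul_digitWeight hθ hθ1 hb)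

lemma exists_coding {M : ℕ} (hM : 1 ≤ M) (d : ℕ → ℕ) {t : ℝ} (h0 : 0 ≤ t) (h1 : t < 1) :
    ∃ (a : ℕ → ℕ) (r : ℕ → ℝ), r 0 = t ∧ (∀ i, 1 ≤ a i) ∧ (∀ n, 0 ≤ r n ∧ r n < 1) ∧
      ∀ n, DigitStep M (d n) (denRatio a n) (r n) (a n) (r (n + 1)) := by
  have h : ∀ (d : ℕ) (θ r : ℝ), ∃ b r', (0 ≤ θ ∧ 0 ≤ r ∧ r < 1) → DigitStep M d θ r b r' := by
    intro d θ r
    by_cases hr : 0 ≤ θ ∧ 0 ≤ r ∧ r < 1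
    · obtain ⟨b, r', h⟩ := exists_digitStep hM d hr.1 hr.2.1 hr.2.2
      exact ⟨b, r', fun _ => h⟩
    · exact ⟨0, 0, fun h => absurd h hr⟩
  choose B R hBR using h
  -- The state is (θ, r): the slots depend on the past only through θ = q_{n-1}/q_n, which obeys its
  -- own recursion.
  let S : ℕ → ℝ × ℝ := fun n => Nat.rec (0, t)
    (fun n p => (1 / (B (d n) p.1 p.2 + p.1), R (d n) p.1 p.2)) n
  have hS : ∀ n, S (n + 1) = (1 / (B (d n) (S n).1 (S n).2 + (S n).1), R (d n) (S n).1 (S n).2) :=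
    fun n => rfl
  have hinv : ∀ n, 0 ≤ (S n).1 ∧ 0 ≤ (S n).2 ∧ (S n).2 < 1 := by
    intro n
    induction n with
    | zero => exact ⟨le_rfl, h0, h1⟩
    | succ n ih =>
      obtain ⟨-, hr0, hr1, -⟩ := hBR (d n) _ _ ih
      rw [hS]
      exact ⟨by have := ih.1; positivity, hr0, hr1⟩
  have ha : ∀ n, 1 ≤ B (d n) (S n).1 (S n).2 := fun n => (hBR (d n) _ _ (hinv n)).1
  have hθ : ∀ n, denRatio (fun n => B (d n) (S n).1 (S n).2) n = (S n).1 := by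
    intro n
    induction n with
    | zero => simp [denRatio, denPair, S]
    | succ n ih => rw [denRatio_succ ha, ih, hS]
  refine ⟨fun n => B (d n) (S n).1 (S n).2, fun n => (S n).2, rfl, ha, fun n => (hinv n).2,
    fun n => ?_⟩
  rw [hθ]
  exact hBR (d n) _ _ (hinv n)

/-- A mass distribution in disguise: the parameters coded into one cylinder span at most its length
times the accumulated cost. -/
lemma abs_sub_le_of_coding {M : ℕ} (hM : 1 ≤ M) {d a b : ℕ → ℕ} {r s : ℕ → ℝ}
    (ha : ∀ i, 1 ≤ a i)
    (hr : ∀ n, DigitStep M (d n) (denRatio a n) (r n) (a n) (r (n + 1)))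
    (hs : ∀ n, DigitStep M (d n) (denRatio b n) (s n) (b n) (s (n + 1)))
    {n : ℕ} (h : ∀ i < n, a i = b i) :
    |r 0 - s 0| ≤ totalCost M d n * cylLength a n * |r n - s n| := by
  induction n with
  | zero => simp [totalCost, cylLength, denPair]
  | succ n ih =>
    have hab : ∀ i < n, a i = b i := fun i hi => h i (by omega)
    have hb := hs n
    rw [← h n (by omega), show denRatio b n = denRatio a n by
      rw [denRatio, denRatio, denPair_congr hab]] at hb
    have hθ := denRatio_mem_Icc ha n
    have h1 := (hr n).abs_sub_le hM hθ.1 hθ.2 hb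
    have h2 := cylLength_pos ha n
    have h3 := one_le_totalCost hM d n
    calc _ ≤ totalCost M d n * cylLength a n * |r n - s n| := ih hab
      _ ≤ totalCost M d n * cylLength a n *
          (digitCost M (d n) * digitWeight (denRatio a n) (a n) * |r (n + 1) - s (n + 1)|) := by
        gcongr
      _ = _ := by
        rw [totalCost_succ, cylLength_succ ha]
        ring

/-! ### Hölder estimate and dimension bound -/

lemma cylLength_le_of_obeys {M : ℕ} (hM : 1 ≤ M) {d a b : ℕ → ℕ} (ha : Obeys M d a)
    (hb : Obeys M d b) {n : ℕ} (h : ∀ i < n, a i = b i) (hn : a n ≠ b n) :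
    cylLength a n ≤
      2 * (M + 1) ^ 3 * totalCost M d (n + 2) ^ 3 * |cfVal a - cfVal b| := by
  have ha1 := fun i => (ha i).1
  have hb1 := fun i => (hb i).1
  have h1 := cylLength_mul_le_abs_cfVal_sub ha1 hb1 h
  have h2 := abs_cfVal_sub_of_ne (a := fun i => a (i + n)) (b := fun i => b (i + n))
    (B := (M + 1) * totalCost M d (n + 2))
    (fun i => ha1 _) (fun i => hb1 _) (by simpa using hn)
    (ha.add_one_le hM (by omega)) (ha.add_one_le hM (by omega))
    (hb.add_one_le hM (by omega)) (hb.add_one_le hM (by omega))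
  have h3 := cylLength_pos ha1 n
  have h4 := one_le_totalCost hM d (n + 2)
  set y := |cfVal (fun i => a (i + n)) - cfVal (fun i => b (i + n))|
  set B := (M + 1) * totalCost M d (n + 2) with hB
  calc _ ≤ cylLength a n * (B ^ 3 * y) := le_mul_of_one_le_right h3.le h2
    _ = B ^ 3 * (cylLength a n * y) := by ring
    _ ≤ B ^ 3 * (2 * |cfVal a - cfVal b|) := by gcongr
    _ = _ := by rw [hB]; ring

/-- With l the cylinder length and K the cost, split l = l^(1-s) · l^s. The first factor is at most
2^(-(1-s)n), the second is bounded by the gap estimate. The fourth power in `hC` is one K from the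
mass and K³ from the gap. -/
lemma abs_sub_le_rpow_of_coding {M : ℕ} (hM : 1 ≤ M) {d a b : ℕ → ℕ} {s C : ℝ} (hs0 : 0 < s)
    (hs1 : s < 1) (hC : ∀ n, totalCost M d (n + 2) ^ 4 ≤ C * ((2 : ℝ) ^ (1 - s)) ^ n)
    (ha : Obeys M d a) (hb : Obeys M d b) {n : ℕ} (h : ∀ i < n, a i = b i) (hn : a n ≠ b n) :
    totalCost M d n * cylLength a n ≤
      C * (2 * ((M : ℝ) + 1) ^ 3) ^ s * |cfVal a - cfVal b| ^ s := by
  have ha1 := fun i => (ha i).1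
  have h1 := cylLength_le_of_obeys hM ha hb h hn
  have h2 := cylLength_le ha1 n
  have h3 := cylLength_pos ha1 n
  have h4 := one_le_totalCost hM d (n + 2)
  have h5 := totalCost_mono hM d (show n ≤ n + 2 by omega)
  have h6 := hC n
  set K := totalCost M d (n + 2)
  set x := |cfVal a - cfVal b| with hx
  set l := cylLength a n
  have hx0 : 0 ≤ x := abs_nonneg _
  have hl : l = l ^ (1 - s) * l ^ s := by rw [← Real.rpow_add h3]; simp
  have hl1 : l ^ (1 - s) ≤ (((2 : ℝ) ^ (1 - s)) ^ n)⁻¹ := by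
    calc l ^ (1 - s) ≤ ((1 / 2 : ℝ) ^ n) ^ (1 - s) :=
          Real.rpow_le_rpow h3.le h2 (by linarith)
      _ = _ := by
        rw [← Real.rpow_natCast, ← Real.rpow_natCast, ← Real.rpow_mul (by norm_num),
          ← Real.rpow_mul (by norm_num), one_div, Real.inv_rpow (by norm_num), mul_comm]
  have hK : (K ^ 3) ^ s ≤ K ^ 3 := by
    conv_rhs => rw [← Real.rpow_one (K ^ 3)]
    exact Real.rpow_le_rpow_of_exponent_le (one_le_pow₀ h4) hs1.le
  have hl2 : l ^ s ≤ (2 * ((M : ℝ) + 1) ^ 3) ^ s * K ^ 3 * x ^ s := by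
    calc l ^ s ≤ (2 * ((M : ℝ) + 1) ^ 3 * K ^ 3 * x) ^ s := Real.rpow_le_rpow h3.le h1 hs0.le
      _ = (2 * ((M : ℝ) + 1) ^ 3) ^ s * (K ^ 3) ^ s * x ^ s := by
        rw [Real.mul_rpow (by positivity) hx0, Real.mul_rpow (by positivity) (by positivity)]
      _ ≤ _ := by gcongr
  have hP : 0 < ((2 : ℝ) ^ (1 - s)) ^ n := by positivity
  calc totalCost M d n * l ≤ K * l := by gcongr
    _ = K * (l ^ (1 - s) * l ^ s) := by rw [← hl]
    _ ≤ K * ((((2 : ℝ) ^ (1 - s)) ^ n)⁻¹ * ((2 * ((M : ℝ) + 1) ^ 3) ^ s * K ^ 3 * x ^ s)) := by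
      gcongr
    _ = K ^ 4 * (((2 : ℝ) ^ (1 - s)) ^ n)⁻¹ * ((2 * ((M : ℝ) + 1) ^ 3) ^ s * x ^ s) := by ring
    _ ≤ C * ((2 * ((M : ℝ) + 1) ^ 3) ^ s * x ^ s) := by
      gcongr
      rwa [mul_inv_le_iff₀ hP]
    _ = _ := by ring

lemma eq_zero_of_abs_le_mul_cylLength {M : ℕ} (hM : 1 ≤ M) {d a : ℕ → ℕ} {s C : ℝ} (hs0 : 0 < s)
    (hC : ∀ n, totalCost M d (n + 2) ^ 4 ≤ C * ((2 : ℝ) ^ (1 - s)) ^ n)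
    (ha : ∀ i, 1 ≤ a i) {y : ℝ} (hy : ∀ n, |y| ≤ totalCost M d n * cylLength a n) : y = 0 := by
  have hq : (2 : ℝ) ^ (1 - s) * (1 / 2) < 1 := by
    have : (2 : ℝ) ^ (1 - s) < 2 ^ (1 : ℝ) :=
      Real.rpow_lt_rpow_of_exponent_lt (by norm_num) (by linarith)
    rw [Real.rpow_one] at this
    linarith
  have h1 : Tendsto (fun n : ℕ => C * ((2 : ℝ) ^ (1 - s) * (1 / 2)) ^ n) atTop (𝓝 (C * 0)) :=
    (tendsto_pow_atTop_nhds_zero_of_lt_one (by positivity) hq).const_mul C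
  rw [mul_zero] at h1
  rw [← abs_nonpos_iff]
  refine ge_of_tendsto' h1 fun n => (hy n).trans ?_
  have h4 := one_le_totalCost hM d (n + 2)
  have h5 := totalCost_mono hM d (show n ≤ n + 2 by omega)
  have h6 : totalCost M d (n + 2) ≤ totalCost M d (n + 2) ^ 4 :=
    le_self_pow₀ h4 (by norm_num)
  rw [mul_pow, ← mul_assoc]
  exact mul_le_mul ((h5.trans h6).trans (hC n)) (cylLength_le ha n) (cylLength_pos ha n).le
    (by linarith [hC n, one_le_pow₀ h4 (n := 4)])

theorem le_dimH_obeys {M : ℕ} (hM : 1 ≤ M) {d : ℕ → ℕ} {s : NNReal} {C : ℝ} (hs0 : 0 < s)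
    (hs1 : s < 1)
    (hC : ∀ n, totalCost M d (n + 2) ^ 4 ≤ C * ((2 : ℝ) ^ (1 - (s : ℝ))) ^ n) :
    (s : ENNReal) ≤ dimH {x : ℝ | ∃ a, Obeys M d a ∧ cfVal a = x} := by
  have hs0' : (0 : ℝ) < s := by exact_mod_cast hs0
  have hs1' : (s : ℝ) < 1 := by exact_mod_cast hs1
  have hcode : ∀ t : ℝ, ∃ (a : ℕ → ℕ) (r : ℕ → ℝ), t ∈ Set.Ico (0 : ℝ) 1 → r 0 = t ∧
      (∀ i, 1 ≤ a i) ∧ (∀ n, 0 ≤ r n ∧ r n < 1) ∧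
      ∀ n, DigitStep M (d n) (denRatio a n) (r n) (a n) (r (n + 1)) := by
    intro t
    by_cases ht : t ∈ Set.Ico (0 : ℝ) 1
    · obtain ⟨a, r, h⟩ := exists_coding hM d ht.1 ht.2
      exact ⟨a, r, fun _ => h⟩
    · exact ⟨0, 0, fun h => absurd h ht⟩
  choose a r har using hcode
  have hob : ∀ t ∈ Set.Ico (0 : ℝ) 1, Obeys M d (a t) := by
    intro t ht i
    obtain ⟨h1, -, -, h2⟩ := (har t ht).2.2.2 i
    refine ⟨h1, fun hd => ?_, fun hd => ?_⟩
    · rcases h2 with h2 | h2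
      · exact h2.2.1
      · exact absurd hd h2.1
    · rcases h2 with h2 | h2
      · exact absurd h2.1 hd
      · exact h2.2.1
  have hC0 : 0 ≤ C := by
    have := hC 0
    rw [pow_zero, mul_one] at this
    exact le_trans (by positivity) this
  set D : ℝ := C * (2 * ((M : ℝ) + 1) ^ 3) ^ (s : ℝ) with hD
  have hD0 : 0 ≤ D := by positivity
  have key : ∀ t ∈ Set.Ico (0 : ℝ) 1, ∀ u ∈ Set.Ico (0 : ℝ) 1,
      |t - u| ≤ D * |cfVal (a t) - cfVal (a u)| ^ (s : ℝ) := by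
    intro t ht u hu
    obtain ⟨ht0, ht1, ht2, ht3⟩ := har t ht
    obtain ⟨hu0, hu1, hu2, hu3⟩ := har u hu
    have hbound : ∀ n, (∀ i < n, a t i = a u i) →
        |t - u| ≤ totalCost M d n * cylLength (a t) n := by
      intro n hn
      have h1 := abs_sub_le_of_coding hM ht1 ht3 hu3 hn
      rw [ht0, hu0] at h1
      refine h1.trans (mul_le_of_le_one_right ?_ ?_)
      · exact mul_nonneg (by linarith [one_le_totalCost hM d n]) (cylLength_pos ht1 n).le
      · rw [abs_le]
        constructor <;> linarith [ht2 n, hu2 n, (ht2 n).1, (hu2 n).1, (ht2 n).2, (hu2 n).2]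
    by_cases heq : ∀ n, a t n = a u n
    · have := eq_zero_of_abs_le_mul_cylLength hM hs0' hC ht1
        (fun n => hbound n fun i _ => heq i)
      rw [this, abs_zero]
      positivity
    · push Not at heq
      classical
      have h1 : ∀ i < Nat.find heq, a t i = a u i := fun i hi => by
        simpa using Nat.find_min heq hi
      exact (hbound _ h1).trans (abs_sub_le_rpow_of_coding hM hs0' hs1' hC (hob t ht) (hob u hu) h1
        (Nat.find_spec heq))
  have hinj : Set.InjOn (fun t => cfVal (a t)) (Set.Ico (0 : ℝ) 1) := by
    intro t ht u hu h
    have := key t ht u hu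
    simp only at h
    rw [h, sub_self, abs_zero, Real.zero_rpow hs0'.ne', mul_zero] at this
    exact sub_eq_zero.1 (abs_nonpos_iff.1 this)
  have hinv := hinj.leftInvOn_invFunOn
  set g := Function.invFunOn (fun t => cfVal (a t)) (Set.Ico (0 : ℝ) 1)
  set E := (fun t => cfVal (a t)) '' Set.Ico (0 : ℝ) 1
  have hhol : HolderOnWith D.toNNReal s g E := by
    rintro _ ⟨t, ht, rfl⟩ _ ⟨u, hu, rfl⟩
    rw [hinv ht, hinv hu, edist_dist, edist_dist, Real.dist_eq, Real.dist_eq,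
      ENNReal.ofReal_rpow_of_nonneg (abs_nonneg _) hs0'.le,
      ← ENNReal.ofReal_coe_nnreal (p := D.toNNReal), Real.coe_toNNReal _ hD0,
      ← ENNReal.ofReal_mul hD0]
    exact ENNReal.ofReal_le_ofReal (key t ht u hu)
  -- An s-Hölder map raises dimension by at most the factor 1/s, and the image [0,1) has dimension
  -- 1.
  have h1 := hhol.dimH_image_le hs0
  have h2 : g '' E = Set.Ico 0 1 := hinv.image_image
  rw [h2, Real.dimH_of_nonempty_interior (by rw [interior_Ico]; exact ⟨1 / 2, by norm_num⟩),
    ENNReal.le_div_iff_mul_le (Or.inl (by simpa using hs0.ne')) (Or.inl (by simp))] at h1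
  simp only [Module.finrank_self, Nat.cast_one, one_mul] at h1
  refine h1.trans (dimH_mono ?_)
  rintro _ ⟨t, ht, rfl⟩
  exact ⟨a t, hob t ht, rfl⟩

/-! ### Blocks of three digits: sum of products and cost -/

/-- The prescriptions attached to a nondecreasing `u`: the `j`-th block of three digits is
`1, u (j + 1) - u j, 1` if `u (j + 1) ≠ u j`, and is free otherwise. -/
def blockDigits (u : ℕ → ℕ) (i : ℕ) : ℕ :=
  if u (i / 3 + 1) - u (i / 3) = 0 then 0
  else if i % 3 = 1 then u (i / 3 + 1) - u (i / 3) else 1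

lemma blockDigits_mul (u : ℕ → ℕ) (j : ℕ) :
    blockDigits u (3 * j) = if u (j + 1) - u j = 0 then 0 else 1 := by
  simp [blockDigits]

lemma blockDigits_mul_add_one (u : ℕ → ℕ) (j : ℕ) :
    blockDigits u (3 * j + 1) = u (j + 1) - u j := by
  have h1 : (3 * j + 1) / 3 = j := by omega
  have h2 : (3 * j + 1) % 3 = 1 := by omega
  simp only [blockDigits, h1, h2]
  split_ifs <;> omega

lemma blockDigits_mul_add_two (u : ℕ → ℕ) (j : ℕ) :
    blockDigits u (3 * j + 2) = if u (j + 1) - u j = 0 then 0 else 1 := by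
  have h1 : (3 * j + 2) / 3 = j := by omega
  have h2 : (3 * j + 2) % 3 = 2 := by omega
  simp [blockDigits, h1, h2]

/-- The outer ones isolate the large digit: its two products give 2d, and the third product is the
first digit of the next block, which is at most M in either kind of block. -/
lemma Obeys.block_bounds {M : ℕ} (hM : 1 ≤ M) {u a : ℕ → ℕ}
    (h : Obeys M (blockDigits u) a) (j : ℕ) :
    2 * (u (j + 1) - u j) ≤ a (3 * j) * a (3 * j + 1) + a (3 * j + 1) * a (3 * j + 2) +
        a (3 * j + 2) * a (3 * j + 3) ∧
      a (3 * j) * a (3 * j + 1) + a (3 * j + 1) * a (3 * j + 2) + a (3 * j + 2) * a (3 * j + 3) ≤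
        2 * (u (j + 1) - u j) + 3 * M ^ 2 := by
  have hfirst : ∀ j, a (3 * j) ≤ M := by
    intro j
    obtain ⟨-, h2, h3⟩ := h (3 * j)
    rw [blockDigits_mul] at h2 h3
    split_ifs at h2 h3 with hj
    · exact h2 rfl
    · rw [h3 one_ne_zero]; exact hM
  have hnext : a (3 * j + 3) ≤ M := hfirst (j + 1)
  obtain ⟨-, p2, p3⟩ := h (3 * j)
  obtain ⟨-, q2, q3⟩ := h (3 * j + 1)
  obtain ⟨-, r2, r3⟩ := h (3 * j + 2)
  rw [blockDigits_mul] at p2 p3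
  rw [blockDigits_mul_add_one] at q2 q3
  rw [blockDigits_mul_add_two] at r2 r3
  by_cases hj : u (j + 1) - u j = 0
  · simp only [hj, if_true, forall_const] at p2 q2 r2
    rw [hj]
    refine ⟨by omega, ?_⟩
    have h1 := Nat.mul_le_mul p2 q2
    have h2 := Nat.mul_le_mul q2 r2
    have h3 := Nat.mul_le_mul r2 hnext
    nlinarith
  · simp only [hj, if_false] at p3 q3 r3
    rw [p3 one_ne_zero, q3 hj, r3 one_ne_zero]
    have : M ≤ M ^ 2 := Nat.le_self_pow (by norm_num) M
    constructor <;> omega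

lemma Obeys.sum_bounds {M : ℕ} (hM : 1 ≤ M) {u a : ℕ → ℕ} (hu : Monotone u)
    (h : Obeys M (blockDigits u) a) (J : ℕ) :
    2 * u J ≤ ∑ i ∈ Finset.range (3 * J), a i * a (i + 1) + 2 * u 0 ∧
      ∑ i ∈ Finset.range (3 * J), a i * a (i + 1) ≤ 2 * u J + 3 * M ^ 2 * J := by
  induction J with
  | zero => simp
  | succ J ih =>
    have h1 := h.block_bounds hM J
    have h2 : u J ≤ u (J + 1) := hu (Nat.le_succ J)
    rw [show 3 * (J + 1) = 3 * J + 1 + 1 + 1 from rfl, Finset.sum_range_succ,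
      Finset.sum_range_succ, Finset.sum_range_succ, mul_add (3 * M ^ 2)]
    simp only [add_assoc] at h1 ⊢
    norm_num at h1 ⊢
    omega

lemma totalCost_blockDigits_succ (M : ℕ) {u : ℕ → ℕ} (J : ℕ) :
    totalCost M (blockDigits u) (3 * (J + 1)) = totalCost M (blockDigits u) (3 * J) *
      if u (J + 1) - u J = 0 then (((M : ℝ) + 2) / M) ^ 3
      else 216 * ((u (J + 1) - u J : ℕ) : ℝ) ^ 2 := by
  rw [show 3 * (J + 1) = 3 * J + 1 + 1 + 1 from rfl, totalCost_succ, totalCost_succ,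
    totalCost_succ, blockDigits_mul, blockDigits_mul_add_one,
    show 3 * J + 1 + 1 = 3 * J + 2 from rfl, blockDigits_mul_add_two]
  split_ifs with h
  · simp only [digitCost, h, if_true]
    ring
  · simp only [digitCost, h, if_false, one_ne_zero]
    push_cast
    ring

/-- Every forced block raises k, so at most k(J) of the first J blocks are forced. Each of these
costs 6 · 6d² · 6 = 216d². -/
lemma totalCost_blockDigits_le {M : ℕ} (hM : 1 ≤ M) {u k : ℕ → ℕ} (hu : Monotone u)
    (hk : Monotone k) (huk : ∀ j, k (j + 1) = k j → u (j + 1) = u j) (J : ℕ) :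
    totalCost M (blockDigits u) (3 * J) ≤
      (((M : ℝ) + 2) / M) ^ (3 * J) * (216 * ((u J : ℝ) + 1) ^ 2) ^ k J := by
  have hM' : (1 : ℝ) ≤ M := by exact_mod_cast hM
  have hB : ∀ j, (1 : ℝ) ≤ 216 * ((u j : ℝ) + 1) ^ 2 := fun j => by
    have : (0 : ℝ) ≤ u j := by positivity
    nlinarith
  have hA : 1 ≤ ((M : ℝ) + 2) / M := by rw [le_div_iff₀ (by positivity)]; linarith
  induction J with
  | zero => simpa [totalCost] using one_le_pow₀ (hB 0)
  | succ J ih =>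
    have huJ : (u J : ℝ) ≤ u (J + 1) := by exact_mod_cast hu (Nat.le_succ J)
    have hkJ : k J ≤ k (J + 1) := hk (Nat.le_succ J)
    have hmono : 216 * ((u J : ℝ) + 1) ^ 2 ≤ 216 * ((u (J + 1) : ℝ) + 1) ^ 2 := by gcongr
    rw [totalCost_blockDigits_succ]
    split_ifs with h
    · calc _ ≤ (((M : ℝ) + 2) / M) ^ (3 * J) * (216 * ((u J : ℝ) + 1) ^ 2) ^ k J *
            (((M : ℝ) + 2) / M) ^ 3 := by gcongr
        _ = (((M : ℝ) + 2) / M) ^ (3 * (J + 1)) * (216 * ((u J : ℝ) + 1) ^ 2) ^ k J := by ring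
        _ ≤ _ := by
          gcongr
          exact (pow_le_pow_left₀ (by linarith [hB J]) hmono _).trans
            (pow_le_pow_right₀ (hB _) hkJ)
    · have hlt : k J + 1 ≤ k (J + 1) := by
        refine Nat.succ_le_of_lt (lt_of_le_of_ne hkJ fun he => h ?_)
        rw [huk J he.symm, Nat.sub_self]
      have hd : ((u (J + 1) - u J : ℕ) : ℝ) ≤ u (J + 1) + 1 := by
        have : u (J + 1) - u J ≤ u (J + 1) + 1 := by omega
        exact_mod_cast this
      calc _ ≤ (((M : ℝ) + 2) / M) ^ (3 * J) * (216 * ((u (J + 1) : ℝ) + 1) ^ 2) ^ k J *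
            (216 * ((u (J + 1) : ℝ) + 1) ^ 2) := by
            gcongr
            refine ih.trans ?_
            gcongr
        _ = (((M : ℝ) + 2) / M) ^ (3 * J) * (216 * ((u (J + 1) : ℝ) + 1) ^ 2) ^ (k J + 1) := by
          rw [pow_succ]; ring
        _ ≤ _ := by
          apply mul_le_mul
          · exact pow_le_pow_right₀ hA (by omega)
          · exact pow_le_pow_right₀ (hB _) hlt
          · exact (zero_le_one.trans (one_le_pow₀ (hB _)))
          · positivity

/-! ### A sparse staircase asymptotic to the identity -/

/-- The level `k` with `exp (k ^ γ) ≤ y < exp ((k + 1) ^ γ)`, for `y ≥ 1`. -/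
noncomputable def level (γ y : ℝ) : ℕ := ⌊(max 0 (Real.log y)) ^ γ⁻¹⌋₊

/-- Half of the largest `exp (k ^ γ)` below `y`, rounded down to an integer. -/
noncomputable def staircase (γ y : ℝ) : ℕ := ⌊Real.exp ((level γ y : ℝ) ^ γ) / 2⌋₊

lemma level_mono {γ x y : ℝ} (hγ : 0 < γ) (hx : 0 < x) (h : x ≤ y) : level γ x ≤ level γ y := by
  unfold level
  gcongr

lemma staircase_mono {γ x y : ℝ} (hγ : 0 < γ) (hx : 0 < x) (h : x ≤ y) :
    staircase γ x ≤ staircase γ y := by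
  have := level_mono hγ hx h
  unfold staircase
  gcongr

lemma level_le {γ y : ℝ} (hy : 1 ≤ y) : (level γ y : ℝ) ≤ Real.log y ^ γ⁻¹ := by
  have h := Real.log_nonneg hy
  unfold level
  rw [max_eq_right h]
  exact Nat.floor_le (by positivity)

lemma staircase_le {γ y : ℝ} (hγ : 0 < γ) (hy : 1 ≤ y) : (staircase γ y : ℝ) ≤ y := by
  have h := Real.log_nonneg hy
  have h1 : (level γ y : ℝ) ^ γ ≤ Real.log y := by
    calc (level γ y : ℝ) ^ γ ≤ (Real.log y ^ γ⁻¹) ^ γ :=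
          Real.rpow_le_rpow (by positivity) (level_le hy) hγ.le
      _ = _ := Real.rpow_inv_rpow h hγ.ne'
  have h2 : Real.exp ((level γ y : ℝ) ^ γ) ≤ y := by
    rw [← Real.le_log_iff_exp_le (by linarith)]
    exact h1
  have h3 := Nat.floor_le (a := Real.exp ((level γ y : ℝ) ^ γ) / 2) (by positivity)
  unfold staircase
  linarith

lemma tendsto_level {γ : ℝ} (hγ : 0 < γ) : Tendsto (level γ) atTop atTop := by
  unfold level
  refine tendsto_nat_floor_atTop.comp ((tendsto_rpow_atTop (inv_pos.2 hγ)).comp ?_)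
  exact tendsto_atTop_mono (fun y => le_max_right 0 _) Real.tendsto_log_atTop

lemma rpow_add_one_sub_le {γ x : ℝ} (hγ : 0 ≤ γ) (hγ1 : γ ≤ 1) (hx : 0 < x) :
    (x + 1) ^ γ - x ^ γ ≤ x ^ (γ - 1) := by
  have h1 := rpow_one_add_le_one_add_mul_self (s := 1 / x)
    (by have : 0 < 1 / x := by positivity
        linarith) hγ hγ1
  have h2 : x + 1 = x * (1 + 1 / x) := by field_simp
  rw [h2, Real.mul_rpow hx.le (by positivity), Real.rpow_sub_one hx.ne']
  have h3 : 0 < x ^ γ := by positivity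
  calc x ^ γ * (1 + 1 / x) ^ γ - x ^ γ ≤ x ^ γ * (1 + γ * (1 / x)) - x ^ γ := by gcongr
    _ = γ * (x ^ γ / x) := by ring
    _ ≤ _ := mul_le_of_le_one_left (by positivity) hγ1

/-- Here γ < 1 is essential: (k + 1)^γ - k^γ ≤ k^(γ-1) tends to 0, so rounding log y down to some
k^γ loses o(1). -/
lemma tendsto_level_rpow_sub_log {γ : ℝ} (hγ : 0 < γ) (hγ1 : γ < 1) :
    Tendsto (fun y : ℝ => (level γ y : ℝ) ^ γ - Real.log y) atTop (𝓝 0) := by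
  have h1 : Tendsto (fun y : ℝ => -(level γ y : ℝ) ^ (γ - 1)) atTop (𝓝 0) := by
    have h := tendsto_rpow_neg_atTop (y := 1 - γ) (by linarith)
    have h' := (h.comp (tendsto_natCast_atTop_atTop.comp (tendsto_level hγ))).neg
    simpa [Function.comp_def] using h'
  refine tendsto_of_tendsto_of_tendsto_of_le_of_le' h1 tendsto_const_nhds ?_ ?_
  · filter_upwards [eventually_ge_atTop 1, (tendsto_level hγ).eventually_ge_atTop 1] with y hy hk
    have h := Real.log_nonneg hy
    have hk' : (0 : ℝ) < level γ y := by exact_mod_cast hk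
    have h2 : Real.log y ^ γ⁻¹ < level γ y + 1 := by
      rw [level, max_eq_right h]
      exact Nat.lt_floor_add_one _
    have h3 : Real.log y ≤ ((level γ y : ℝ) + 1) ^ γ := by
      rw [← Real.rpow_inv_rpow h hγ.ne']
      exact Real.rpow_le_rpow (by positivity) h2.le hγ.le
    linarith [rpow_add_one_sub_le hγ.le hγ1.le hk']
  · filter_upwards [eventually_ge_atTop 1] with y hy
    have h := Real.log_nonneg hy
    have : (level γ y : ℝ) ^ γ ≤ (Real.log y ^ γ⁻¹) ^ γ :=
      Real.rpow_le_rpow (by positivity) (level_le hy) hγ.le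
    rw [Real.rpow_inv_rpow h hγ.ne'] at this
    linarith

lemma tendsto_staircase_div {γ : ℝ} (hγ : 0 < γ) (hγ1 : γ < 1) :
    Tendsto (fun y : ℝ => 2 * (staircase γ y : ℝ) / y) atTop (𝓝 1) := by
  have h1 : Tendsto (fun y : ℝ => Real.exp ((level γ y : ℝ) ^ γ - Real.log y)) atTop (𝓝 1) := by
    have := (Real.continuous_exp.tendsto 0).comp (tendsto_level_rpow_sub_log hγ hγ1)
    rwa [Real.exp_zero] at this
  have h2 : Tendsto (fun y : ℝ => Real.exp ((level γ y : ℝ) ^ γ) / 2) atTop atTop :=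
    (Real.tendsto_exp_atTop.comp ((tendsto_rpow_atTop hγ).comp
      (tendsto_natCast_atTop_atTop.comp (tendsto_level hγ)))).atTop_div_const (by norm_num)
  have h3 := ((tendsto_nat_floor_div_atTop (R := ℝ)).comp h2).mul h1
  rw [one_mul] at h3
  refine h3.congr' ?_
  filter_upwards [eventually_gt_atTop 0] with y hy
  rw [Real.exp_sub, Real.exp_log hy]
  simp only [Function.comp_apply, staircase]
  have := Real.exp_pos ((level γ y : ℝ) ^ γ)
  field_simp

/-! ### Growth of φ: asymptotics of the sum and subexponential cost -/

section Growth

variable {φ : ℕ → ℝ}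

lemma tendsto_atTop_of_div (hlin : Tendsto (fun n : ℕ => φ n / (n : ℝ)) atTop atTop) :
    Tendsto φ atTop atTop := by
  refine tendsto_atTop_mono' _ ?_ tendsto_natCast_atTop_atTop
  filter_upwards [hlin.eventually_ge_atTop 1, eventually_gt_atTop 0] with n h hn
  have hn' : (0 : ℝ) < n := by exact_mod_cast hn
  rwa [le_div_iff₀ hn', one_mul] at h

lemma tendsto_shift_div (hpos : ∀ n : ℕ, 1 ≤ n → 0 < φ n)
    (hratio : Tendsto (fun n : ℕ => φ (n + 1) / φ n) atTop (𝓝 1)) (k : ℕ) :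
    Tendsto (fun n : ℕ => φ (n + k) / φ n) atTop (𝓝 1) := by
  induction k with
  | zero =>
    refine tendsto_const_nhds.congr' ?_
    filter_upwards [eventually_ge_atTop 1] with n hn
    rw [add_zero, div_self (hpos n hn).ne']
  | succ k ih =>
    have h := (hratio.comp (tendsto_add_atTop_nat k)).mul ih
    rw [one_mul] at h
    refine h.congr' ?_
    filter_upwards [eventually_ge_atTop 1] with n hn
    have h1 := (hpos (n + k) (by omega)).ne'
    simp only [Function.comp_apply]
    rw [div_mul_div_cancel₀ h1, add_assoc]

lemma tendsto_comp_div (hpos : ∀ n : ℕ, 1 ≤ n → 0 < φ n) (hmono : MonotoneOn φ (Set.Ici 1))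
    (hratio : Tendsto (fun n : ℕ => φ (n + 1) / φ n) atTop (𝓝 1)) {f : ℕ → ℕ} {k l : ℕ}
    (hf1 : ∀ n, 1 ≤ f n) (hfk : ∀ n, n ≤ f n + k) (hfl : ∀ n, f n ≤ n + l) :
    Tendsto (fun n : ℕ => φ (f n) / φ n) atTop (𝓝 1) := by
  have hf : Tendsto f atTop atTop := by
    refine tendsto_atTop_mono (f := fun n => n - k) (fun n => ?_) (tendsto_sub_atTop_nat k)
    have := hfk n
    omega
  have h1 : Tendsto (fun n => φ (f n) / φ (f n + k)) atTop (𝓝 1) := by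
    have := ((tendsto_shift_div hpos hratio k).comp hf).inv₀ one_ne_zero
    rw [inv_one] at this
    refine this.congr fun n => ?_
    simp
  refine tendsto_of_tendsto_of_tendsto_of_le_of_le' h1 (tendsto_shift_div hpos hratio l) ?_ ?_
  · filter_upwards [eventually_ge_atTop 1] with n hn
    have h2 := hpos n hn
    have h3 := hpos _ (hf1 n)
    have h4 := hmono hn (show 1 ≤ f n + k by have := hf1 n; omega) (hfk n)
    gcongr
  · filter_upwards [eventually_ge_atTop 1] with n hn
    have h2 := hpos n hn
    have h4 := hmono (hf1 n) (show 1 ≤ n + l by omega) (hfl n)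
    gcongr

lemma exists_log_le_rpow (hlin : Tendsto (fun n : ℕ => φ n / (n : ℝ)) atTop atTop)
    (hlimsup : limsup (fun n : ℕ =>
        ((Real.log (Real.log (φ n)) / Real.log (n : ℝ) : ℝ) : EReal)) atTop
      < ((1 / 2 : ℝ) : EReal)) :
    ∃ β : ℝ, 0 < β ∧ β < 1 / 2 ∧ ∀ᶠ n : ℕ in atTop, Real.log (φ n) ≤ (n : ℝ) ^ β := by
  obtain ⟨β, hβ1, hβ2⟩ := EReal.lt_iff_exists_real_btwn.1 hlimsup
  have hβ3 : β < 1 / 2 := by exact_mod_cast hβ2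
  -- The maximum with 1/4 only makes the exponent positive.
  refine ⟨max β (1 / 4), lt_max_of_lt_right (by norm_num), max_lt hβ3 (by norm_num), ?_⟩
  have hlog := Real.tendsto_log_atTop.comp (tendsto_atTop_of_div hlin)
  filter_upwards [eventually_lt_of_limsup_lt hβ1, hlog.eventually_gt_atTop 0,
    eventually_gt_atTop 1] with n h1 h2 hn
  have hn' : (1 : ℝ) < n := by exact_mod_cast hn
  have h3 : Real.log (Real.log (φ n)) / Real.log n < β := by exact_mod_cast h1
  have h4 := Real.log_pos hn'
  rw [div_lt_iff₀ h4] at h3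
  calc Real.log (φ n) = Real.exp (Real.log (Real.log (φ n))) := (Real.exp_log h2).symm
    _ ≤ Real.exp (Real.log n * β) := by
      gcongr
      linarith
    _ = (n : ℝ) ^ β := (Real.rpow_def_of_pos (by linarith) β).symm
    _ ≤ _ := Real.rpow_le_rpow_of_exponent_le hn'.le (le_max_left _ _)

/-- The integers whose increments are the large digits, for the growth function `φ`. -/
noncomputable def growthSteps (γ : ℝ) (φ : ℕ → ℝ) (j : ℕ) : ℕ := staircase γ (φ (3 * j + 1))

lemma growthSteps_mono {γ : ℝ} (hγ : 0 < γ) (hpos : ∀ n : ℕ, 1 ≤ n → 0 < φ n)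
    (hmono : MonotoneOn φ (Set.Ici 1)) : Monotone (growthSteps γ φ) := fun i j hij =>
  staircase_mono hγ (hpos _ (by omega)) (hmono (show 1 ≤ 3 * i + 1 by omega)
    (show 1 ≤ 3 * j + 1 by omega) (by omega))

lemma tendsto_growthSteps_div {γ : ℝ} (hγ : 0 < γ) (hγ1 : γ < 1)
    (hpos : ∀ n : ℕ, 1 ≤ n → 0 < φ n) (hmono : MonotoneOn φ (Set.Ici 1))
    (hlin : Tendsto (fun n : ℕ => φ n / (n : ℝ)) atTop atTop)
    (hratio : Tendsto (fun n : ℕ => φ (n + 1) / φ n) atTop (𝓝 1)) (i : ℕ) :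
    Tendsto (fun n : ℕ => 2 * (growthSteps γ φ (n / 3 + i) : ℝ) / φ n) atTop (𝓝 1) := by
  have h1 := tendsto_comp_div hpos hmono hratio (f := fun n => 3 * (n / 3 + i) + 1) (k := 2)
    (l := 3 * i + 1) (fun n => by omega) (fun n => by omega) (fun n => by omega)
  have h2 : Tendsto (fun n : ℕ => 3 * (n / 3 + i) + 1) atTop atTop :=
    tendsto_atTop_mono (f := fun n => n - 2) (fun n => by omega) (tendsto_sub_atTop_nat 2)
  have h3 := ((tendsto_staircase_div hγ hγ1).comp ((tendsto_atTop_of_div hlin).comp h2)).mul h1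
  rw [one_mul] at h3
  refine h3.congr fun n => ?_
  have h4 := (hpos (3 * (n / 3 + i) + 1) (by omega)).ne'
  simp only [Function.comp_apply, growthSteps]
  rw [div_mul_div_cancel₀ h4]

lemma tendsto_sum_div {γ : ℝ} (hγ : 0 < γ) (hγ1 : γ < 1)
    (hpos : ∀ n : ℕ, 1 ≤ n → 0 < φ n) (hmono : MonotoneOn φ (Set.Ici 1))
    (hlin : Tendsto (fun n : ℕ => φ n / (n : ℝ)) atTop atTop)
    (hratio : Tendsto (fun n : ℕ => φ (n + 1) / φ n) atTop (𝓝 1)) {M : ℕ} (hM : 1 ≤ M)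
    {a : ℕ → ℕ} (ha : Obeys M (blockDigits (growthSteps γ φ)) a) :
    Tendsto (fun n : ℕ => ((∑ i ∈ Finset.range n, a i * a (i + 1) : ℕ) : ℝ) / φ n)
      atTop (𝓝 1) := by
  have hu := growthSteps_mono hγ hpos hmono
  have hφ := tendsto_atTop_of_div hlin
  have hc : ∀ c : ℝ, Tendsto (fun n => c / φ n) atTop (𝓝 0) := fun c => hφ.const_div_atTop c
  have hn : Tendsto (fun n : ℕ => (n : ℝ) / φ n) atTop (𝓝 0) :=
    hlin.inv_tendsto_atTop.congr fun n => by simp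
  have hlow := (tendsto_growthSteps_div hγ hγ1 hpos hmono hlin hratio 0).sub
    (hc (2 * (growthSteps γ φ 0 : ℝ)))
  have hup := ((tendsto_growthSteps_div hγ hγ1 hpos hmono hlin hratio 1).add
    (hn.const_mul (3 * (M : ℝ) ^ 2))).add (hc (3 * (M : ℝ) ^ 2))
  simp only [sub_zero, mul_zero, add_zero] at hlow hup
  refine tendsto_of_tendsto_of_tendsto_of_le_of_le' hlow hup ?_ ?_
  · filter_upwards [eventually_ge_atTop 1] with n hn1
    have h1 := hpos n hn1
    have h2 := (ha.sum_bounds hM hu (n / 3)).1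
    have h3 : ∑ i ∈ Finset.range (3 * (n / 3)), a i * a (i + 1) ≤
        ∑ i ∈ Finset.range n, a i * a (i + 1) :=
      Finset.sum_le_sum_of_subset (Finset.range_subset_range.2 (by omega))
    rw [← sub_div]
    gcongr
    rw [sub_le_iff_le_add]
    exact_mod_cast h2.trans (Nat.add_le_add_right h3 _)
  · filter_upwards [eventually_ge_atTop 1] with n hn1
    have h1 := hpos n hn1
    have h2 := (ha.sum_bounds hM hu (n / 3 + 1)).2
    have h3 : ∑ i ∈ Finset.range n, a i * a (i + 1) ≤
        ∑ i ∈ Finset.range (3 * (n / 3 + 1)), a i * a (i + 1) :=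
      Finset.sum_le_sum_of_subset (Finset.range_subset_range.2 (by omega))
    have h4 : 3 * M ^ 2 * (n / 3 + 1) ≤ 3 * M ^ 2 * n + 3 * M ^ 2 := by
      rw [← Nat.mul_succ]
      exact Nat.mul_le_mul_left _ (by omega)
    rw [mul_div_assoc', ← add_div, ← add_div]
    gcongr
    exact_mod_cast (show _ ≤ _ by omega)

lemma eventually_level_mul_log_le {γ β : ℝ} (hγ : 0 < γ) (hβγ : β + β / γ < 1)
    (hφ : Tendsto φ atTop atTop) (hβ : ∀ᶠ n : ℕ in atTop, Real.log (φ n) ≤ (n : ℝ) ^ β)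
    {ε : ℝ} (hε : 0 < ε) :
    ∀ᶠ n : ℕ in atTop, level γ (φ n) * Real.log (216 * ((staircase γ (φ n) : ℝ) + 1) ^ 2) ≤
      ε * n := by
  have h0 : Tendsto (fun n : ℕ => (n : ℝ) ^ (-(1 - (β + β / γ)))) atTop (𝓝 0) :=
    (tendsto_rpow_neg_atTop (by linarith)).comp tendsto_natCast_atTop_atTop
  filter_upwards [hβ, hφ.eventually_ge_atTop 864, eventually_gt_atTop 0,
    h0.eventually_le_const (show 0 < ε / 3 by positivity)] with n h1 h2 hn h3
  have hn' : (0 : ℝ) < n := by exact_mod_cast hn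
  have hy : 1 ≤ φ n := by linarith
  have hL := Real.log_nonneg hy
  have h4 := level_le (γ := γ) hy
  have h5 := staircase_le hγ hy
  have h6 : Real.log (216 * ((staircase γ (φ n) : ℝ) + 1) ^ 2) ≤ 3 * Real.log (φ n) := by
    rw [show 3 * Real.log (φ n) = Real.log (φ n ^ 3) by rw [Real.log_pow]; norm_num]
    -- 216(2φ)² = 864φ² ≤ φ³, hence the threshold 864.
    apply Real.log_le_log (by positivity)
    have h7 : ((staircase γ (φ n) : ℝ) + 1) ^ 2 ≤ (2 * φ n) ^ 2 := by
      gcongr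
      linarith
    nlinarith [sq_nonneg (φ n)]
  have h7 : Real.log (φ n) ^ γ⁻¹ ≤ (n : ℝ) ^ (β / γ) := by
    rw [div_eq_mul_inv, Real.rpow_mul hn'.le]
    exact Real.rpow_le_rpow hL h1 (by positivity)
  calc _ ≤ Real.log (φ n) ^ γ⁻¹ * (3 * Real.log (φ n)) :=
        mul_le_mul h4 h6 (Real.log_nonneg (by
          have : (0 : ℝ) ≤ staircase γ (φ n) := by positivity
          nlinarith)) (by positivity)
    _ ≤ (n : ℝ) ^ (β / γ) * (3 * (n : ℝ) ^ β) := by gcongr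
    _ = 3 * ((n : ℝ) ^ (-(1 - (β + β / γ))) * n) := by
      rw [← Real.rpow_add_one hn'.ne', mul_left_comm, ← Real.rpow_add hn']
      congr 2
      ring
    _ ≤ 3 * (ε / 3 * n) := by gcongr
    _ = _ := by ring

lemma exists_totalCost_le {γ β : ℝ} (hγ : 0 < γ) (hβγ : β + β / γ < 1)
    (hpos : ∀ n : ℕ, 1 ≤ n → 0 < φ n) (hmono : MonotoneOn φ (Set.Ici 1))
    (hφ : Tendsto φ atTop atTop) (hβ : ∀ᶠ n : ℕ in atTop, Real.log (φ n) ≤ (n : ℝ) ^ β)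
    {ρ : ℝ} (hρ : 1 < ρ) :
    ∃ M : ℕ, 1 ≤ M ∧ ∃ C : ℝ, ∀ n,
      totalCost M (blockDigits (growthSteps γ φ)) (n + 2) ^ 4 ≤ C * ρ ^ n := by
  have hlρ := Real.log_pos hρ
  obtain ⟨M, hM, hMρ⟩ : ∃ M : ℕ, 1 ≤ M ∧ Real.log (((M : ℝ) + 2) / M) ≤ Real.log ρ / 8 := by
    have h1 : Tendsto (fun M : ℕ => Real.log (((M : ℝ) + 2) / M)) atTop (𝓝 0) := by
      have h2 : Tendsto (fun M : ℕ => 1 + 2 / (M : ℝ)) atTop (𝓝 (1 + 0)) :=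
        (tendsto_const_div_atTop_nhds_zero_nat 2).const_add 1
      rw [add_zero] at h2
      have h3 := h2.log one_ne_zero
      rw [Real.log_one] at h3
      refine h3.congr' ?_
      filter_upwards [eventually_gt_atTop 0] with M hM
      have hM' : (0 : ℝ) < M := by exact_mod_cast hM
      congr 1
      field_simp
    exact ((eventually_ge_atTop 1).and
      (h1.eventually_le_const (show 0 < Real.log ρ / 8 by positivity))).exists
  refine ⟨M, hM, ?_⟩
  have hM' : (1 : ℝ) ≤ M := by exact_mod_cast hM
  set u := growthSteps γ φ with hu
  set K := totalCost M (blockDigits u) with hK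
  have hJ : Tendsto (fun n : ℕ => 3 * (n / 3 + 2) + 1) atTop atTop :=
    tendsto_atTop_mono (f := fun n => n) (fun n => by omega) tendsto_id
  have hev : ∀ᶠ n : ℕ in atTop, K (n + 2) ^ 4 / ρ ^ n ≤ ρ ^ 6 := by
    filter_upwards [hJ.eventually (eventually_level_mul_log_le hγ hβγ hφ hβ
      (show 0 < Real.log ρ / 10 by positivity))] with n hn
    have hcost := totalCost_blockDigits_le hM (k := fun j => level γ (φ (3 * j + 1)))
      (growthSteps_mono hγ hpos hmono)
      (fun i j hij => level_mono hγ (hpos _ (by omega)) (hmono (show 1 ≤ 3 * i + 1 by omega)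
        (show 1 ≤ 3 * j + 1 by omega) (by omega)))
      (fun j hj => by simp only [growthSteps, staircase, hj]) (n / 3 + 2)
    rw [← hu, ← hK] at hcost
    have hle : K (n + 2) ≤ K (3 * (n / 3 + 2)) := totalCost_mono hM _ (by omega)
    have hone : 1 ≤ K (n + 2) := one_le_totalCost hM _ _
    have hlog : Real.log (K (n + 2)) ≤ 3 * ((n / 3 + 2 : ℕ) : ℝ) * Real.log (((M : ℝ) + 2) / M) +
        level γ (φ (3 * (n / 3 + 2) + 1)) * Real.log (216 * ((u (n / 3 + 2) : ℝ) + 1) ^ 2) := by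
      refine (Real.log_le_log (by linarith) (hle.trans hcost)).trans_eq ?_
      rw [Real.log_mul (by positivity) (by positivity), Real.log_pow, Real.log_pow]
      push_cast
      ring
    have hn2 : (level γ (φ (3 * (n / 3 + 2) + 1)) : ℝ) *
        Real.log (216 * ((u (n / 3 + 2) : ℝ) + 1) ^ 2) ≤
        Real.log ρ / 10 * (3 * ((n / 3 + 2 : ℕ) : ℝ) + 1) := by
      refine hn.trans_eq ?_
      push_cast
      ring
    have hJ2 : (2 : ℝ) ≤ ((n / 3 + 2 : ℕ) : ℝ) := by
      exact_mod_cast (show 2 ≤ n / 3 + 2 by omega)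
    have hJ3 : 3 * ((n / 3 + 2 : ℕ) : ℝ) ≤ n + 6 := by
      exact_mod_cast (show 3 * (n / 3 + 2) ≤ n + 6 by omega)
    set J : ℝ := ((n / 3 + 2 : ℕ) : ℝ)
    -- In units of log ρ the left side is at most 4(3J/8 + (3J + 1)/10) = 2.7J + 0.4, which is at
    -- most 3J ≤ n + 6 because J ≥ 2.
    have hfin : 4 * Real.log (K (n + 2)) ≤ (6 + n) * Real.log ρ := by
      have e1 : 3 * J * Real.log (((M : ℝ) + 2) / M) ≤ 3 * J * (Real.log ρ / 8) := by gcongr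
      have e2 : Real.log ρ * (3 * J) ≤ Real.log ρ * (n + 6) := by gcongr
      have e3 : Real.log ρ * 2 ≤ Real.log ρ * J := by gcongr
      nlinarith
    rw [div_le_iff₀ (by positivity), ← pow_add, ← Real.log_le_log_iff (by positivity)
      (by positivity), Real.log_pow, Real.log_pow]
    push_cast
    exact hfin
  -- Finitely many exceptional n are absorbed into C.
  obtain ⟨C, hC⟩ := (isBoundedUnder_of_eventually_le hev).bddAbove_range
  refine ⟨C, fun n => ?_⟩
  rw [← div_le_iff₀ (by positivity)]
  exact hC ⟨n, rfl⟩

end Growth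

/-! ### Conclusion -/

lemma cfVal_mem_levelSet {φ : ℕ → ℝ} {a : ℕ → ℕ} (ha : ∀ i, 1 ≤ a i)
    (h : Tendsto (fun n : ℕ => ((∑ i ∈ Finset.range n, a i * a (i + 1) : ℕ) : ℝ) / φ n)
      atTop (𝓝 1)) : cfVal a ∈ levelSet φ :=
  ⟨⟨cfVal_pos ha, cfVal_lt_one ha⟩, irrational_cfVal ha,
    h.congr fun n => by rw [productSum_cfVal n ha]⟩

end ContFracSum

open ContFracSum

theorem theorem1p6 (φ : ℕ → ℝ)
    (hpos : ∀ n : ℕ, 1 ≤ n → 0 < φ n)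
    (hmono : MonotoneOn φ (Set.Ici 1))
    (hlin : Tendsto (fun n : ℕ => φ n / (n : ℝ)) atTop atTop)
    (hratio : Tendsto (fun n : ℕ => φ (n + 1) / φ n) atTop (𝓝 1))
    (hlimsup : limsup (fun n : ℕ =>
        ((Real.log (Real.log (φ n)) / Real.log (n : ℝ) : ℝ) : EReal)) atTop
      < ((1 / 2 : ℝ) : EReal)) :
    dimH (ContFracSum.levelSet φ) = 1 := by
  refine le_antisymm ?_ ?_
  · exact (dimH_mono (Set.subset_univ _)).trans_eq Real.dimH_univ
  obtain ⟨β, hβ0, hβ1, hβ⟩ := exists_log_le_rpow hlin hlimsup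
  -- γ > β/(1 - β) means β + β/γ < 1; it is compatible with γ < 1 exactly because β < 1/2.
  obtain ⟨γ, hγ1, hγ2⟩ : ∃ γ, β / (1 - β) < γ ∧ γ < 1 :=
    exists_between (by rw [div_lt_one (by linarith)]; linarith)
  have hγ0 : 0 < γ := lt_trans (div_pos hβ0 (by linarith)) hγ1
  have hβγ : β + β / γ < 1 := by
    rw [div_lt_iff₀ (by linarith)] at hγ1
    have : β / γ < 1 - β := by rw [div_lt_iff₀ hγ0]; linarith
    linarith
  refine le_of_forall_lt fun c hc => ?_
  obtain ⟨s, hcs, hs1⟩ := ENNReal.lt_iff_exists_nnreal_btwn.1 hc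
  have hs1' : s < 1 := by exact_mod_cast hs1
  have hs0 : 0 < s := by exact_mod_cast (zero_le (a := c)).trans_lt hcs
  have hρ : 1 < (2 : ℝ) ^ (1 - (s : ℝ)) :=
    Real.one_lt_rpow (by norm_num) (by have : (s : ℝ) < 1 := by exact_mod_cast hs1'
                                       linarith)
  obtain ⟨M, hM, C, hC⟩ := exists_totalCost_le hγ0 hβγ hpos hmono (tendsto_atTop_of_div hlin) hβ hρ
  refine hcs.trans_le ((le_dimH_obeys hM hs0 hs1' hC).trans (dimH_mono ?_))
  rintro _ ⟨a, ha, rfl⟩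
  exact cfVal_mem_levelSet (fun i => (ha i).1)
    (tendsto_sum_div hγ0 hγ2 hpos hmono hlin hratio hM ha)
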